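/- Theorem 5.6. Let $g:\mathbb{R}\to\mathbb{C}$ be square-integrable, and suppose that there is $x_0\in\mathbb{R}$ such that, on $(x_0,\infty)$, each of the functions $x\mapsto g(x)$ and $x\mapsto g(-x)$ takes only positive real values and is decreasing (in the wide sense, i.e. non-increasing). Let $\Lambda=\{(\alpha_k,\beta_k)\}_{k=0}^{3}\subseteq\mathbb{R}^2$ be a set of four distinct points. Then the HRT (Heil–Ramanathan–Topiwala) conjecture holds for the Gabor system $\mathcal{G}(g,\Lambda)$; that is, the four functions $$e^{2\pi i\beta_k x}\,g(x-\alpha_k),\qquad k=0,1,2,3,$$ are linearly independent over $\mathbb{C}$ in $L^2(\mathbb{R})$. -/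

import Mathlib

open MeasureTheory Filter
open scoped ComplexOrder

/-- The time-frequency shift `x ↦ e^{2πiβx} g(x - α)` of `g` by the point `p = (α, β)`. -/
noncomputable def gaborShift (g : ℝ → ℂ) (p : ℝ × ℝ) (x : ℝ) : ℂ :=
  Complex.exp (2 * Real.pi * Complex.I * p.2 * x) * g (x - p.1)

theorem gaborShift_memLp {g : ℝ → ℂ} (hg : MemLp g 2 volume) (p : ℝ × ℝ) :
    MemLp (gaborShift g p) 2 volume := by
  have h1 : MemLp (fun x : ℝ => g (x - p.1)) 2 volume :=
    hg.comp_measurePreserving (measurePreserving_sub_right volume p.1)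
  refine h1.of_le (AEStronglyMeasurable.mul ?_ h1.1) (Eventually.of_forall fun x => ?_)
  · exact (Continuous.aestronglyMeasurable (by fun_prop))
  · have h2 : (2 * Real.pi * Complex.I * p.2 * x : ℂ)
        = ((2 * Real.pi * p.2 * x : ℝ) : ℂ) * Complex.I := by
      push_cast; ring
    unfold gaborShift
    rw [norm_mul, h2, Complex.norm_exp_ofReal_mul_I, one_mul]

/-- The finite Gabor system `𝒢(g, Λ) = {e^{2πiβx} g(x - α)}`, `(α, β) ∈ Λ`, as a family of elements
of the complex Hilbert space `L²(ℝ)` indexed by the points of the finite set `Λ ⊆ ℝ²`. -/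
noncomputable def gaborSystem (g : ℝ → ℂ) (hg : MemLp g 2 volume) (Λ : Finset (ℝ × ℝ)) :
    {p : ℝ × ℝ // p ∈ Λ} → Lp ℂ 2 (volume : Measure ℝ) :=
  fun p => (gaborShift_memLp hg p.1).toLp (gaborShift g p.1)

/-- The HRT conjecture holds for `𝒢(g, Λ)`: the system is linearly independent in `L²(ℝ)`. -/
def HRTHolds (g : ℝ → ℂ) (hg : MemLp g 2 volume) (Λ : Finset (ℝ × ℝ)) : Prop :=
  LinearIndependent ℂ (gaborSystem g hg Λ)

/-- `f(x)` is a positive real number for all sufficiently large `x`.  (In the order of `ℂ` used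
here, `0 < z` means that `z` is real and positive.) -/
def UltimatelyPositive (f : ℝ → ℂ) : Prop :=
  ∃ x₀ : ℝ, ∀ x : ℝ, x₀ < x → 0 < f x

/-- `f` is decreasing, in the wide sense, on some half-line `(x₀, ∞)`.  (In the order of `ℂ` used
here, `w ≤ z` means that `z - w` is real and nonnegative.) -/
def UltimatelyDecreasing (f : ℝ → ℂ) : Prop :=
  ∃ x₀ : ℝ, AntitoneOn f (Set.Ioi x₀)

/-!
A dependency `∑ cₖ e^{2πiβₖx} g(x - αₖ) = 0` says, for large `|x|`, that the rotating vectors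
`cₖ e^{2πiβₖx}` have a vanishing combination with positive weights `g(x - αₖ)`. The proof depends on
which of the frequencies `βₖ` of the nonzero terms coincide.

If they are all distinct, the positivity of `g` near `+∞` suffices (`weighted_waves_ne_zero`): if
`N ≤ 4` unit vectors have a vanishing combination with positive weights, their sum has norm at most
`N - 2 ≤ √N`, whereas the quadratic mean of the sum of the rotating unit vectors is `√N`. So the
nonnegative function `N - ‖∑ uₖ e^{2πiβₖx}‖²` has mean zero, hence no Fourier coefficients at all;
but the difference of the largest and the smallest frequency occurs in it.

If they all coincide, this is a dependency of translates, which the Fourier transform on `L²` turns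
into the product of the transform of `g` with a trigonometric polynomial
(`ae_eq_zero_of_sum_translates`).

In the other cases the monotonicity is used through `DecayingTails.exists_sign`: a real combination
`d₀ g(x - α₀) + d₁ g(x - α₁)` has a constant weak sign near `+∞` or near `-∞`, because the translate
that dominates near `+∞` is dominated near `-∞`. So such a combination cannot cancel a term that
oscillates on both sides. If all frequencies but one coincide, projecting along one of the
coefficients leaves exactly this situation (`DecayingTails.not_ae_three_add_wave_eq_zero`).
Otherwise there are two terms of the same frequency and two terms of other frequencies. Either the
coefficients of the first two are opposite, and the projection along them shows that the remaining
two terms have the same translate of `g` and add up to a real oscillation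
(`DecayingTails.not_ae_collinear_pair`); or they lie in a common open half-plane, which the other
two rotating vectors can then never enter simultaneously, so that these are opposite to each other
and the roles are exchanged (`DecayingTails.not_ae_pair_add_waves_eq_zero`).
-/

/-! ### Waves and their means -/

/-- The pure wave `x ↦ e^{2πiβx}` of frequency `β`. -/
noncomputable def wave (β x : ℝ) : ℂ :=
  Complex.exp (2 * Real.pi * Complex.I * β * x)

theorem wave_eq_exp_ofReal_mul_I (β x : ℝ) :
    wave β x = Complex.exp (((2 * Real.pi * β * x : ℝ) : ℂ) * Complex.I) := by
  unfold wave; congr 1; push_cast; ring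

theorem norm_wave (β x : ℝ) : ‖wave β x‖ = 1 := by
  rw [wave_eq_exp_ofReal_mul_I, Complex.norm_exp_ofReal_mul_I]

theorem wave_ne_zero (β x : ℝ) : wave β x ≠ 0 := Complex.exp_ne_zero _

theorem wave_add (β γ x : ℝ) : wave (β + γ) x = wave β x * wave γ x := by
  unfold wave; rw [← Complex.exp_add]; congr 1; push_cast; ring

theorem wave_add_right (β x y : ℝ) : wave β (x + y) = wave β x * wave β y := by
  unfold wave; rw [← Complex.exp_add]; congr 1; push_cast; ring

@[simp] theorem wave_zero (x : ℝ) : wave 0 x = 1 := by simp [wave]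

theorem conj_wave (β x : ℝ) : (starRingEnd ℂ) (wave β x) = wave (-β) x := by
  unfold wave; rw [← Complex.exp_conj]; congr 1; simp [Complex.conj_ofNat]

theorem wave_neg_mul_wave (β x : ℝ) : wave (-β) x * wave β x = 1 := by
  rw [← wave_add]; simp

theorem wave_re (β x : ℝ) : (wave β x).re = Real.cos (2 * Real.pi * β * x) := by
  rw [wave_eq_exp_ofReal_mul_I, Complex.exp_ofReal_mul_I_re]

theorem wave_im (β x : ℝ) : (wave β x).im = Real.sin (2 * Real.pi * β * x) := by
  rw [wave_eq_exp_ofReal_mul_I, Complex.exp_ofReal_mul_I_im]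

theorem contDiff_wave (β : ℝ) {n : WithTop ℕ∞} : ContDiff ℝ n (wave β) := by
  have h : wave β = fun x : ℝ => Complex.exp (2 * Real.pi * Complex.I * β * x) := rfl
  rw [h]
  exact (contDiff_const.mul Complex.ofRealCLM.contDiff).cexp

@[fun_prop] theorem continuous_wave (β : ℝ) : Continuous (wave β) :=
  (contDiff_wave β (n := 0)).continuous

/-- A wave of nonzero frequency takes every unimodular value arbitrarily far to the right. -/
theorem exists_gt_wave_eq {β : ℝ} (hβ : β ≠ 0) {z : ℂ} (hz : ‖z‖ = 1) (X : ℝ) :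
    ∃ x, X < x ∧ wave β x = z := by
  have hz' : Complex.exp (Complex.arg z * Complex.I) = z := by
    have := Complex.norm_mul_exp_arg_mul_I z
    rwa [hz, Complex.ofReal_one, one_mul] at this
  -- translating by the period `1 / |β|` often enough
  obtain ⟨n, hn⟩ := exists_nat_gt ((X - z.arg / (2 * Real.pi * β)) * |β|)
  have hb : 0 < |β| := abs_pos.mpr hβ
  refine ⟨z.arg / (2 * Real.pi * β) + n / |β|, ?_, ?_⟩
  · rw [← lt_div_iff₀ hb] at hn
    linarith
  · rw [wave_add_right]
    have h1 : wave β (z.arg / (2 * Real.pi * β)) = z := by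
      rw [wave_eq_exp_ofReal_mul_I]
      have : 2 * Real.pi * β * (z.arg / (2 * Real.pi * β)) = z.arg := by
        field_simp
      rw [this, hz']
    have h2 : wave β (n / |β|) = 1 := by
      unfold wave
      rw [Complex.exp_eq_one_iff]
      rcases abs_choice β with h | h <;> rw [h]
      · refine ⟨n, ?_⟩
        have : (β : ℂ) ≠ 0 := by exact_mod_cast hβ
        push_cast; field_simp
      · refine ⟨-n, ?_⟩
        have : (β : ℂ) ≠ 0 := by exact_mod_cast hβ
        push_cast; field_simp
    rw [h1, h2, mul_one]

/-- `m` is the mean value of the continuous function `f` along the half-line `(X, ∞)`. -/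
structure HasMean (X : ℝ) (f : ℝ → ℂ) (m : ℂ) : Prop where
  continuous : Continuous f
  tendsto : Tendsto (fun T : ℝ => (T : ℂ)⁻¹ * ∫ x in X..X + T, f x) atTop (nhds m)

namespace HasMean

variable {X : ℝ} {f g : ℝ → ℂ} {m n : ℂ}

theorem const_mul (h : HasMean X f m) (c : ℂ) : HasMean X (fun x => c * f x) (c * m) := by
  refine ⟨continuous_const.mul h.1, ?_⟩
  refine (h.2.const_mul c).congr fun T => ?_
  rw [intervalIntegral.integral_const_mul]; ring

theorem sum {ι : Type*} (s : Finset ι) {f : ι → ℝ → ℂ} {m : ι → ℂ}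
    (h : ∀ i ∈ s, HasMean X (f i) (m i)) :
    HasMean X (fun x => ∑ i ∈ s, f i x) (∑ i ∈ s, m i) := by
  refine ⟨continuous_finsetSum s fun i hi => (h i hi).1, ?_⟩
  refine (tendsto_finsetSum s fun i hi => (h i hi).2).congr fun T => ?_
  rw [intervalIntegral.integral_finsetSum fun i hi => (h i hi).1.intervalIntegrable _ _,
    Finset.mul_sum]

theorem sub (hf : HasMean X f m) (hg : HasMean X g n) :
    HasMean X (fun x => f x - g x) (m - n) := by
  refine ⟨hf.1.sub hg.1, ?_⟩
  refine (hf.2.sub hg.2).congr fun T => ?_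
  rw [intervalIntegral.integral_sub (hf.1.intervalIntegrable _ _) (hg.1.intervalIntegrable _ _)]
  ring

theorem unique (hf : HasMean X f m) (hf' : HasMean X f n) : m = n :=
  tendsto_nhds_unique hf.2 hf'.2

theorem zero : HasMean X (fun _ => 0) 0 :=
  ⟨continuous_const, by simp⟩

/-- Waves of nonzero frequency have mean zero. -/
theorem wave (X β : ℝ) : HasMean X (wave β) (if β = 0 then 1 else 0) := by
  refine ⟨continuous_wave β, ?_⟩
  split_ifs with hβ
  · subst hβ
    refine tendsto_const_nhds.congr' ?_
    filter_upwards [eventually_gt_atTop 0] with T hT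
    have : (T : ℂ) ≠ 0 := by exact_mod_cast hT.ne'
    simp [this]
  · have hc : (2 * Real.pi * Complex.I * β : ℂ) ≠ 0 := by
      have : (β : ℂ) ≠ 0 := by exact_mod_cast hβ
      simp [Real.pi_ne_zero, this]
    have key : ∀ T : ℝ, ‖(T : ℂ)⁻¹ * ∫ x in X..X + T, _root_.wave β x‖ ≤
        ‖T⁻¹‖ * (2 / ‖(2 * Real.pi * Complex.I * β : ℂ)‖) := by
      intro T
      have : ∫ x in X..X + T, _root_.wave β x =
          (_root_.wave β (X + T) - _root_.wave β X) / (2 * Real.pi * Complex.I * β) := by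
        unfold _root_.wave
        rw [integral_exp_mul_complex hc]
      rw [this, norm_mul, norm_div, ← Complex.ofReal_inv, Complex.norm_real]
      gcongr
      refine (norm_sub_le _ _).trans ?_
      rw [norm_wave, norm_wave]; norm_num
    refine squeeze_zero_norm key ?_
    have := (tendsto_inv_atTop_zero (𝕜 := ℝ)).norm.mul_const
      (2 / ‖(2 * Real.pi * Complex.I * β : ℂ)‖)
    simpa using this

/-- If a nonnegative function has mean zero, then so does its product with a unimodular one. -/
theorem eq_zero_of_nonneg (hf : HasMean X f 0) (hpos : ∀ᵐ x, X < x → 0 ≤ f x)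
    {w : ℝ → ℂ} (hw : ∀ x, ‖w x‖ = 1) (hm : HasMean X (fun x => f x * w x) m) : m = 0 := by
  have hre : Tendsto (fun T : ℝ => ‖(T : ℂ)⁻¹ * ∫ x in X..X + T, f x‖) atTop (nhds 0) := by
    simpa using hf.2.norm
  refine tendsto_nhds_unique hm.2 (squeeze_zero_norm' ?_ hre)
  filter_upwards [eventually_gt_atTop 0] with T hT
  rw [norm_mul, norm_mul]
  gcongr
  have hae : ∀ᵐ x, x ∈ Set.Ioc X (X + T) → ‖f x * w x‖ = (f x).re := by
    filter_upwards [hpos] with x hx hxX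
    have h0 := hx hxX.1
    rw [norm_mul, hw, mul_one]
    simpa using congrArg Complex.re (Complex.norm_of_nonneg' h0)
  have hle : X ≤ X + T := by linarith
  calc ‖∫ x in X..X + T, f x * w x‖ ≤ ∫ x in X..X + T, ‖f x * w x‖ :=
        intervalIntegral.norm_integral_le_integral_norm hle
    _ = ∫ x in X..X + T, (f x).re := by
        refine intervalIntegral.integral_congr_ae ?_
        rwa [Set.uIoc_of_le hle]
    _ = (∫ x in X..X + T, f x).re :=
        intervalIntegral.intervalIntegral_re (hf.1.intervalIntegrable _ _)
    _ ≤ ‖∫ x in X..X + T, f x‖ := Complex.re_le_norm _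

end HasMean

/-! ### Dependencies with distinct frequencies -/

/-- If `0` is a combination of the unit vectors `u i` with positive weights, then the sum of the
`u i` is short. For at most four vectors the bound `N - 2` is at most `√N`, the quadratic mean of
a sum of `N` independently rotating unit vectors. -/
theorem norm_sum_le_of_weighted_sum_eq_zero {ι : Type*} {s : Finset ι} (hs : s.Nonempty)
    {u : ι → ℂ} (hu : ∀ i ∈ s, ‖u i‖ = 1) {w : ι → ℝ} (hw : ∀ i ∈ s, 0 < w i)
    (h : ∑ i ∈ s, (w i : ℂ) * u i = 0) : ‖∑ i ∈ s, u i‖ ≤ s.card - 2 := by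
  classical
  obtain ⟨k, hk, hmax⟩ := s.exists_max_image w hs
  -- the largest weight is at most the sum of the others
  have h1 : 2 * w k ≤ ∑ i ∈ s, w i := by
    have e : (w k : ℂ) * u k = -∑ i ∈ s.erase k, (w i : ℂ) * u i := by
      rw [← Finset.add_sum_erase s _ hk] at h
      exact eq_neg_of_add_eq_zero_left h
    have : w k ≤ ∑ i ∈ s.erase k, w i := by
      calc w k = ‖(w k : ℂ) * u k‖ := by
            rw [norm_mul, hu k hk, mul_one, Complex.norm_real, Real.norm_of_nonneg (hw k hk).le]
        _ ≤ ∑ i ∈ s.erase k, ‖(w i : ℂ) * u i‖ := by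
            rw [e, norm_neg]; exact norm_sum_le _ _
        _ = ∑ i ∈ s.erase k, w i := by
            refine Finset.sum_congr rfl fun i hi => ?_
            have hi' := Finset.mem_of_mem_erase hi
            rw [norm_mul, hu i hi', mul_one, Complex.norm_real,
              Real.norm_of_nonneg (hw i hi').le]
    rw [← Finset.add_sum_erase s _ hk]
    linarith
  have h2 : (w k : ℂ) * ∑ i ∈ s, u i = ∑ i ∈ s, ((w k - w i : ℝ) : ℂ) * u i := by
    simp only [Complex.ofReal_sub, sub_mul, Finset.sum_sub_distrib, h, sub_zero, Finset.mul_sum]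
  have h3 : w k * ‖∑ i ∈ s, u i‖ ≤ w k * (s.card - 2) := by
    calc w k * ‖∑ i ∈ s, u i‖ = ‖(w k : ℂ) * ∑ i ∈ s, u i‖ := by
          rw [norm_mul, Complex.norm_real, Real.norm_of_nonneg (hw k hk).le]
      _ ≤ ∑ i ∈ s, ‖((w k - w i : ℝ) : ℂ) * u i‖ := by rw [h2]; exact norm_sum_le _ _
      _ = ∑ i ∈ s, (w k - w i) := by
          refine Finset.sum_congr rfl fun i hi => ?_
          rw [norm_mul, hu i hi, mul_one, Complex.norm_real,
            Real.norm_of_nonneg (sub_nonneg.mpr (hmax i hi))]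
      _ ≤ w k * (s.card - 2) := by
          rw [Finset.sum_sub_distrib, Finset.sum_const, nsmul_eq_mul]; linarith
  exact le_of_mul_le_mul_left h3 (hw k hk)

/-- At most four waves of distinct frequencies cannot be combined to zero with coefficients of
constant arguments: the squared norm of the sum of the rotating unit vectors is at most their
number `N`, which is also its mean, so `N` minus this squared norm would have no nonzero Fourier
coefficient. But the difference of the largest and the least frequency occurs in it. -/
theorem weighted_waves_ne_zero {ι : Type*} {s : Finset ι} (hs : s.Nonempty) (hcard : s.card ≤ 4)
    {β : ι → ℝ} (hβ : Set.InjOn β s) {c : ι → ℂ} (hc : ∀ i ∈ s, c i ≠ 0)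
    {w : ι → ℝ → ℝ} {X : ℝ} (hw : ∀ i ∈ s, ∀ x, X < x → 0 < w i x) :
    ¬ ∀ᵐ x, X < x → ∑ i ∈ s, c i * wave (β i) x * w i x = 0 := by
  classical
  intro h
  set u : ι → ℂ := fun i => c i / ‖c i‖ with hu
  have hun : ∀ i ∈ s, ‖u i‖ = 1 := fun i hi => by
    have := norm_ne_zero_iff.mpr (hc i hi)
    simp [hu, this]
  have hshort : ∀ᵐ x, X < x → ‖∑ i ∈ s, u i * wave (β i) x‖ ≤ s.card - 2 := by
    filter_upwards [h] with x hx hX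
    refine norm_sum_le_of_weighted_sum_eq_zero hs (w := fun i => ‖c i‖ * w i x) (fun i hi => ?_)
      (fun i hi => mul_pos (norm_pos_iff.mpr (hc i hi)) (hw i hi x hX)) ?_
    · rw [norm_mul, hun i hi, norm_wave, one_mul]
    · rw [← hx hX]
      refine Finset.sum_congr rfl fun i hi => ?_
      have : (‖c i‖ : ℂ) ≠ 0 := by exact_mod_cast norm_ne_zero_iff.mpr (hc i hi)
      simp only [hu]; push_cast; field_simp
  have hcard2 : 2 ≤ s.card := by
    obtain ⟨x, hx, hX⟩ : ∃ x, (X < x → ‖∑ i ∈ s, u i * wave (β i) x‖ ≤ s.card - 2) ∧ X < x := by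
      by_contra! hcon
      have : ∀ᵐ x, x ∉ Set.Ioi X := by
        filter_upwards [hshort] with x hx hX
        exact (hcon x hx).not_gt hX
      have := (measure_eq_zero_iff_ae_notMem (s := Set.Ioi X)).mpr this
      simp at this
    have := (norm_nonneg _).trans (hx hX)
    have : (2 : ℝ) ≤ s.card := by linarith
    exact_mod_cast this
  -- the square of the sum, times a wave, and its mean
  set F : ℝ → ℝ → ℂ := fun δ x =>
    ∑ i ∈ s, ∑ j ∈ s, (u i * (starRingEnd ℂ) (u j)) * wave (β i - β j + δ) x with hF
  have hmean : ∀ δ, HasMean X (F δ) (∑ i ∈ s, ∑ j ∈ s,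
      (u i * (starRingEnd ℂ) (u j)) * (if β i - β j + δ = 0 then 1 else 0)) := fun δ =>
    HasMean.sum s fun i _ => HasMean.sum s fun j _ => (HasMean.wave X _).const_mul _
  have hF0 : ∀ δ x, F δ x = ((‖∑ i ∈ s, u i * wave (β i) x‖ ^ 2 : ℝ) : ℂ) * wave δ x := by
    intro δ x
    rw [Complex.ofReal_pow, ← Complex.mul_conj', map_sum, Finset.sum_mul_sum, Finset.sum_mul]
    refine Finset.sum_congr rfl fun i _ => ?_
    rw [Finset.sum_mul]
    refine Finset.sum_congr rfl fun j _ => ?_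
    rw [map_mul, conj_wave, sub_eq_add_neg, wave_add, wave_add]; ring
  have hm0 : HasMean X (F 0) s.card := by
    convert hmean 0 using 1
    have : ∀ i ∈ s, ∑ j ∈ s, (u i * (starRingEnd ℂ) (u j)) *
        (if β i - β j + 0 = 0 then 1 else 0) = (1 : ℂ) := by
      intro i hi
      rw [Finset.sum_eq_single_of_mem i hi]
      · simp [Complex.mul_conj', hun i hi]
      · intro j hj hji
        rw [if_neg, mul_zero]
        rw [add_zero, sub_eq_zero]
        exact fun e => hji (hβ hj hi e.symm)
    rw [Finset.sum_congr rfl this]; simp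
  obtain ⟨p, hp, hpmin⟩ := s.exists_min_image β hs
  obtain ⟨q, hq, hqmax⟩ := s.exists_max_image β hs
  have hpq : β p < β q := by
    refine lt_of_le_of_ne (hpmin q hq) fun e => ?_
    obtain ⟨a, ha, b, hb, hab⟩ := Finset.one_lt_card.mp hcard2
    refine hab (hβ ha hb ?_)
    linarith [hpmin a ha, hpmin b hb, hqmax a ha, hqmax b hb]
  have hmγ : HasMean X (F (β q - β p)) (u p * (starRingEnd ℂ) (u q)) := by
    convert hmean (β q - β p) using 1
    rw [Finset.sum_eq_single_of_mem p hp, Finset.sum_eq_single_of_mem q hq]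
    · simp
    · intro j hj hjq
      rw [if_neg, mul_zero]
      exact fun e => hjq (hβ hj hq (by linarith))
    · intro i hi hip
      refine Finset.sum_eq_zero fun j hj => ?_
      rw [if_neg, mul_zero]
      intro e
      refine hip (hβ hi hp ?_)
      linarith [hpmin i hi, hqmax j hj]
  have hone : HasMean X (fun _ => (s.card : ℂ)) s.card := by
    simpa using (HasMean.wave X 0).const_mul (s.card : ℂ)
  have hγ0 : HasMean X (fun x => (s.card : ℂ) * wave (β q - β p) x) 0 := by
    have := (HasMean.wave X (β q - β p)).const_mul (s.card : ℂ)
    rwa [if_neg (sub_pos.mpr hpq).ne', mul_zero] at this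
  have hD : HasMean X (fun x => (s.card : ℂ) - F 0 x) 0 := by simpa using hone.sub hm0
  have hnn : ∀ᵐ x, X < x → 0 ≤ (s.card : ℂ) - F 0 x := by
    filter_upwards [hshort] with x hx hX
    rw [hF0, wave_zero, mul_one]
    have h2 : (2 : ℝ) ≤ s.card := by exact_mod_cast hcard2
    have h4 : (s.card : ℝ) ≤ 4 := by exact_mod_cast hcard
    have : ‖∑ i ∈ s, u i * wave (β i) x‖ ^ 2 ≤ s.card := by
      nlinarith [hx hX, norm_nonneg (∑ i ∈ s, u i * wave (β i) x)]
    rw [sub_nonneg]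
    exact_mod_cast this
  have hprod : HasMean X (fun x => ((s.card : ℂ) - F 0 x) * wave (β q - β p) x)
      (0 - u p * (starRingEnd ℂ) (u q)) := by
    convert hγ0.sub hmγ using 2 with x
    rw [hF0, hF0, wave_zero]; ring
  have := hD.eq_zero_of_nonneg hnn (fun x => norm_wave _ x) hprod
  have hn : ‖u p * (starRingEnd ℂ) (u q)‖ = 1 := by
    rw [norm_mul, RCLike.norm_conj, hun p hp, hun q hq, one_mul]
  rw [zero_sub, neg_eq_zero] at this
  simp [this] at hn

/-! ### Linear independence of translates -/

section Translates

open scoped FourierTransform SchwartzMap ContDiff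

/-- A combination of waves of distinct frequencies vanishes only on a null set, unless all its
coefficients are zero: it is analytic, and its mean against a conjugate wave is a coefficient. -/
theorem ae_sum_wave_ne_zero {ι : Type*} {s : Finset ι} {a : ι → ℝ} (ha : Set.InjOn a s)
    {c : ι → ℂ} {k : ι} (hk : k ∈ s) (hc : c k ≠ 0) :
    ∀ᵐ x : ℝ, ∑ i ∈ s, c i * wave (a i) x ≠ 0 := by
  classical
  set P : ℝ → ℂ := fun x => ∑ i ∈ s, c i * wave (a i) x with hP
  have hana : AnalyticOnNhd ℝ P Set.univ := by
    refine Finset.analyticOnNhd_fun_sum _ fun i _ => analyticOnNhd_const.mul fun x _ => ?_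
    exact (contDiff_wave (a i) (n := ω)).contDiffAt.analyticAt
  obtain ⟨x₀, hx₀⟩ : ∃ x, P x ≠ 0 := by
    by_contra! h0
    have h1 : HasMean 0 (fun x => ∑ i ∈ s, c i * wave (a i - a k) x)
        (∑ i ∈ s, c i * (if a i - a k = 0 then 1 else 0)) :=
      HasMean.sum s fun i _ => (HasMean.wave 0 _).const_mul _
    have h2 : (fun x => ∑ i ∈ s, c i * wave (a i - a k) x) = fun _ => 0 := by
      funext x
      have := congrArg (· * wave (-a k) x) (h0 x)
      simp only [hP, Finset.sum_mul, zero_mul] at this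
      rw [← this]
      exact Finset.sum_congr rfl fun i _ => by rw [sub_eq_add_neg, wave_add, mul_assoc]
    rw [h2] at h1
    have h3 := h1.unique HasMean.zero
    rw [Finset.sum_eq_single_of_mem k hk] at h3
    · simp [hc] at h3
    · intro i hi hik
      rw [if_neg, mul_zero]
      exact fun e => hik (ha hi hk (sub_eq_zero.mp e))
  have hco := hana.preimage_zero_mem_codiscrete (x := x₀) hx₀
  have := ae_restrict_le_codiscreteWithin (μ := (volume : Measure ℝ)) MeasurableSet.univ hco
  rwa [Measure.restrict_univ] at this

theorem SchwartzMap.fourierInv_wave_mul {ψ Ψ : 𝓢(ℝ, ℂ)} {a : ℝ}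
    (h : ∀ ξ, Ψ ξ = wave a ξ * ψ ξ) (x : ℝ) : (𝓕⁻ Ψ) x = (𝓕⁻ ψ) (x + a) := by
  rw [SchwartzMap.fourierInv_coe, SchwartzMap.fourierInv_coe, Real.fourierInv_eq',
    Real.fourierInv_eq']
  refine integral_congr_ae (Eventually.of_forall fun ξ => ?_)
  simp only [h, wave, smul_eq_mul, RCLike.inner_apply, conj_trivial]
  rw [← mul_assoc, ← Complex.exp_add]
  congr 2
  push_cast; ring

/-- The translates of a nonzero square-integrable function are linearly independent: the Fourier
transform turns a dependency into a product with a combination of waves, whose zeros form a null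
set. The transform is tested against smooth functions of compact support. -/
theorem ae_eq_zero_of_sum_translates {ι : Type*} {s : Finset ι} {a : ι → ℝ}
    (ha : Set.InjOn a s) {c : ι → ℂ} {k : ι} (hk : k ∈ s) (hc : c k ≠ 0)
    {g : ℝ → ℂ} (hg : MemLp g 2 volume)
    (h : ∀ᵐ x, ∑ i ∈ s, c i * g (x - a i) = 0) : g =ᵐ[volume] 0 := by
  set G : Lp ℂ 2 (volume : Measure ℝ) := 𝓕 (hg.toLp g) with hG
  -- a Schwartz function against the transform
  have hpair : ∀ Ψ : 𝓢(ℝ, ℂ), ∫ ξ, G ξ * (starRingEnd ℂ) (Ψ ξ) =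
      ∫ x, g x * (starRingEnd ℂ) ((𝓕⁻ Ψ) x) := by
    intro Ψ
    have h1 : inner ℂ (Ψ.toLp 2 volume) G = inner ℂ ((𝓕⁻ Ψ).toLp 2 volume) (hg.toLp g) := by
      refine Eq.trans ?_ (Lp.inner_fourier_eq ((𝓕⁻ Ψ).toLp 2 volume) (hg.toLp g))
      rw [SchwartzMap.toLp_fourier_eq, FourierTransform.fourier_fourierInv_eq]
    rw [L2.inner_def, L2.inner_def] at h1
    convert h1 using 1
    · refine integral_congr_ae ?_
      filter_upwards [Ψ.coeFn_toLp 2 volume] with ξ hξ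
      rw [hξ, RCLike.inner_apply]
    · refine integral_congr_ae ?_
      filter_upwards [(𝓕⁻ Ψ).coeFn_toLp 2 volume, hg.coeFn_toLp] with ξ hξ hξ'
      rw [hξ, hξ', RCLike.inner_apply]
  have hprod : ∀ᵐ ξ, (∑ i ∈ s, c i * wave (-a i) ξ) * G ξ = 0 := by
    refine ae_eq_zero_of_integral_contDiff_smul_eq_zero ?_ ?_
    · refine (MemLp.of_le_mul (c := ∑ i ∈ s, ‖c i‖) (Lp.memLp G) ?_
        (Eventually.of_forall fun ξ => ?_)).locallyIntegrable (by norm_num)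
      · exact (continuous_finsetSum s fun i _ => continuous_const.mul
          (continuous_wave _)).aestronglyMeasurable.mul (Lp.memLp G).1
      · rw [norm_mul]
        gcongr
        refine (norm_sum_le _ _).trans_eq (Finset.sum_congr rfl fun i _ => ?_)
        rw [norm_mul, norm_wave, mul_one]
    · intro ψ hψ hψc
      have hψ' : ContDiff ℝ ∞ (fun ξ => (ψ ξ : ℂ)) := Complex.ofRealCLM.contDiff.comp hψ
      have hψc' : HasCompactSupport (fun ξ => (ψ ξ : ℂ)) := hψc.comp_left Complex.ofReal_zero
      set ψs : 𝓢(ℝ, ℂ) := hψc'.toSchwartzMap hψ' with hψs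
      set Ψ : ι → 𝓢(ℝ, ℂ) := fun i => (hψc'.mul_left (f := wave (a i))).toSchwartzMap
        ((contDiff_wave (a i)).mul hψ') with hΨ
      have hGint : ∀ i, Integrable (fun ξ => G ξ * (starRingEnd ℂ) (Ψ i ξ)) := fun i =>
        (Lp.memLp G).integrable_mul ((Ψ i).memLp 2 volume).star
      have hgint : ∀ i, Integrable (fun x => g (x - a i) * (starRingEnd ℂ) ((𝓕⁻ ψs) x)) := fun i =>
        (hg.comp_measurePreserving (measurePreserving_sub_right volume (a i))).integrable_mul
          ((𝓕⁻ ψs).memLp 2 volume).star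
      have hshift : ∀ i, ∫ ξ, G ξ * (starRingEnd ℂ) (Ψ i ξ) =
          ∫ x, g (x - a i) * (starRingEnd ℂ) ((𝓕⁻ ψs) x) := by
        intro i
        rw [hpair, ← integral_sub_right_eq_self _ (a i)]
        refine integral_congr_ae (Eventually.of_forall fun x => ?_)
        have := SchwartzMap.fourierInv_wave_mul (ψ := ψs) (Ψ := Ψ i) (a := a i)
          (fun ξ => rfl) (x - a i)
        simp only [this, sub_add_cancel]
      calc ∫ ξ, ψ ξ • ((∑ i ∈ s, c i * wave (-a i) ξ) * G ξ)
          = ∫ ξ, ∑ i ∈ s, c i * (G ξ * (starRingEnd ℂ) (Ψ i ξ)) := by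
            refine integral_congr_ae (Eventually.of_forall fun ξ => ?_)
            have : ∀ i, Ψ i ξ = wave (a i) ξ * ψ ξ := fun _ => rfl
            simp only [this, map_mul, conj_wave, Complex.conj_ofReal, Complex.real_smul,
              Finset.sum_mul, Finset.mul_sum]
            exact Finset.sum_congr rfl fun i _ => by ring
        _ = ∑ i ∈ s, c i * ∫ x, g (x - a i) * (starRingEnd ℂ) ((𝓕⁻ ψs) x) := by
            rw [integral_finsetSum s fun i _ => (hGint i).const_mul _]
            exact Finset.sum_congr rfl fun i _ => by rw [integral_const_mul, hshift]
        _ = ∫ x, ∑ i ∈ s, c i * (g (x - a i) * (starRingEnd ℂ) ((𝓕⁻ ψs) x)) := by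
            rw [integral_finsetSum s fun i _ => (hgint i).const_mul _]
            exact Finset.sum_congr rfl fun i _ => by rw [integral_const_mul]
        _ = 0 := by
            refine integral_eq_zero_of_ae ?_
            filter_upwards [h] with x hx
            simp only [← mul_assoc, ← Finset.sum_mul, hx, zero_mul, Pi.zero_apply]
  have hG0 : G = 0 := by
    rw [Lp.eq_zero_iff_ae_eq_zero]
    filter_upwards [hprod, ae_sum_wave_ne_zero (a := fun i => -a i)
      (fun i hi j hj hij => ha hi hj (neg_injective hij)) hk hc] with ξ h1 h2
    exact (mul_eq_zero.mp h1).resolve_left h2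
  have hg0 : hg.toLp g = 0 := by
    rw [← norm_eq_zero, ← Lp.norm_fourier_eq, ← hG, hG0, norm_zero]
  have := hg.coeFn_toLp
  rw [hg0] at this
  exact this.symm.trans (Lp.coeFn_zero ℂ 2 volume)

end Translates

/-! ### Rotating vectors and half-planes -/

/-- A property that holds almost everywhere holds somewhere on each nonempty open set. -/
theorem exists_mem_of_isOpen_of_ae {U : Set ℝ} (hU : IsOpen U) (hne : U.Nonempty) {p : ℝ → Prop}
    (hp : ∀ᵐ x, p x) : ∃ x ∈ U, p x := by
  by_contra! hcon
  refine hne.ne_empty (hU.eq_empty_of_measure_zero (μ := volume) ?_)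
  rw [measure_eq_zero_iff_ae_notMem]
  filter_upwards [hp] with x hx hxU using hcon x hxU hx

theorem isOpen_re_mul_wave_pos (b : ℂ) (β : ℝ) : IsOpen {x | 0 < (b * wave β x).re} :=
  isOpen_lt continuous_const (Complex.continuous_re.comp (continuous_const.mul (continuous_wave β)))

theorem exists_gt_mul_wave_eq_norm {β : ℝ} (hβ : β ≠ 0) {b : ℂ} (hb : b ≠ 0) (X : ℝ) :
    ∃ x, X < x ∧ b * wave β x = ‖b‖ := by
  have hn : (‖b‖ : ℂ) ≠ 0 := by exact_mod_cast norm_ne_zero_iff.mpr hb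
  obtain ⟨x, hx, hxw⟩ := exists_gt_wave_eq hβ (z := (starRingEnd ℂ) b / ‖b‖)
    (by rw [norm_div, RCLike.norm_conj, Complex.norm_real, norm_norm, div_self
          (norm_ne_zero_iff.mpr hb)]) X
  refine ⟨x, hx, ?_⟩
  rw [hxw, mul_div_assoc', Complex.mul_conj', div_eq_iff hn]; ring

theorem exists_gt_re_mul_wave_pos {β : ℝ} (hβ : β ≠ 0) {b : ℂ} (hb : b ≠ 0) {p : ℝ → Prop}
    (hp : ∀ᵐ x, p x) (X : ℝ) : ∃ x, X < x ∧ 0 < (b * wave β x).re ∧ p x := by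
  obtain ⟨x, hx, hxw⟩ := exists_gt_mul_wave_eq_norm hβ hb X
  obtain ⟨y, hy, hpy⟩ := exists_mem_of_isOpen_of_ae
    (isOpen_Ioi.inter (isOpen_re_mul_wave_pos b β))
    ⟨x, hx, by rw [Set.mem_ofPred_eq, hxw, Complex.ofReal_re]; exact norm_pos_iff.mpr hb⟩ hp
  exact ⟨y, hy.1, hy.2, hpy⟩

theorem exists_lt_re_mul_wave_pos {β : ℝ} (hβ : β ≠ 0) {b : ℂ} (hb : b ≠ 0) {p : ℝ → Prop}
    (hp : ∀ᵐ x, p x) (X : ℝ) : ∃ x, x < X ∧ 0 < (b * wave β x).re ∧ p x := by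
  obtain ⟨x, hx, hxw, hpx⟩ := exists_gt_re_mul_wave_pos (neg_ne_zero.mpr hβ) hb
    ((Measure.measurePreserving_neg (volume : Measure ℝ)).quasiMeasurePreserving.ae hp) (-X)
  refine ⟨-x, by linarith, ?_, hpx⟩
  have : wave (-β) x = wave β (-x) := by unfold wave; congr 1; push_cast; ring
  rwa [this] at hxw

/-- Two rotating vectors of different positive speeds are simultaneously in the open right
half-plane at some late time: the slower one stays there for longer than the faster one can stay
in the closed left half-plane. -/
theorem exists_gt_re_pos_of_lt {β γ : ℝ} (hβ : 0 < β) (hβγ : β < γ) {a b : ℂ} (ha : a ≠ 0)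
    (hb : b ≠ 0) (X : ℝ) :
    ∃ x, X < x ∧ 0 < (a * wave β x).re ∧ 0 < (b * wave γ x).re := by
  have hγ : 0 < γ := hβ.trans hβγ
  by_contra! hcon
  obtain ⟨x, hx, hxw⟩ := exists_gt_mul_wave_eq_norm hβ.ne' ha (X + 1 / (4 * β))
  set B := b * wave γ x with hB
  have hpi := Real.pi_pos
  have key : ∀ h, |h| < 1 / (4 * β) → (B * wave γ h).re ≤ 0 := by
    intro h hh
    have hh' := abs_lt.mp hh
    have := hcon (x + h) (by linarith) ?_
    · rwa [wave_add_right, ← mul_assoc] at this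
    · rw [wave_add_right, ← mul_assoc, hxw, Complex.re_ofReal_mul, wave_re]
      refine mul_pos (norm_pos_iff.mpr ha) (Real.cos_pos_of_mem_Ioo ?_)
      have h1 : 2 * Real.pi * β * (1 / (4 * β)) = Real.pi / 2 := by field_simp; ring
      have h0 : 0 < 2 * Real.pi * β := by positivity
      constructor
      · nlinarith
      · nlinarith
  have hlt : 1 / (4 * γ) < 1 / (4 * β) := by gcongr
  have hre := key 0 (by simpa using hβ)
  have hq : 2 * Real.pi * γ * (1 / (4 * γ)) = Real.pi / 2 := by field_simp; ring
  have hq' : 2 * Real.pi * γ * (-(1 / (4 * γ))) = -(Real.pi / 2) := by rw [mul_neg, hq]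
  have hp : 0 < 1 / (4 * γ) := by positivity
  have him := key (1 / (4 * γ)) (by rwa [abs_of_pos hp])
  have him' := key (-(1 / (4 * γ))) (by rwa [abs_neg, abs_of_pos hp])
  obtain ⟨h, hh1, hh2⟩ := exists_between
    (lt_min hlt (show 1 / (4 * γ) < 3 * (1 / (4 * γ)) by linarith))
  have hh3 := lt_min_iff.mp hh2
  have hcos : Real.cos (2 * Real.pi * γ * h) < 0 := by
    have h0 : 0 < 2 * Real.pi * γ := by positivity
    refine Real.cos_neg_of_pi_div_two_lt_of_lt ?_ ?_
    · nlinarith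
    · nlinarith
  have hre' := key h (by rw [abs_of_pos (hp.trans hh1)]; exact hh3.1)
  simp only [Complex.mul_re, wave_re, wave_im, hq, hq', mul_zero, Real.cos_zero, Real.sin_zero,
    Real.cos_neg, Real.sin_neg, Real.cos_pi_div_two, Real.sin_pi_div_two] at hre hre' him him'
  have h1 : B.im = 0 := by linarith
  rw [h1, zero_mul, sub_zero] at hre'
  have h2 : B.re = 0 := by nlinarith
  exact mul_ne_zero hb (wave_ne_zero γ x) (Complex.ext h2 h1)

theorem re_mul_wave_neg (a : ℂ) (β x : ℝ) :
    ((starRingEnd ℂ) a * wave (-β) x).re = (a * wave β x).re := by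
  rw [← conj_wave, ← map_mul, Complex.conj_re]

theorem exists_gt_re_pos_of_abs_lt {β γ : ℝ} (hβ : β ≠ 0) (hβγ : |β| < |γ|) {a b : ℂ} (ha : a ≠ 0)
    (hb : b ≠ 0) (X : ℝ) :
    ∃ x, X < x ∧ 0 < (a * wave β x).re ∧ 0 < (b * wave γ x).re := by
  have hflip : ∀ (δ : ℝ) (c : ℂ), c ≠ 0 → ∃ c' : ℂ, c' ≠ 0 ∧
      ∀ x, (c' * wave |δ| x).re = (c * wave δ x).re := by
    intro δ c hc
    rcases abs_choice δ with h | h <;> rw [h]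
    · exact ⟨c, hc, fun _ => rfl⟩
    · exact ⟨(starRingEnd ℂ) c, by simpa using hc, fun x => re_mul_wave_neg c δ x⟩
  obtain ⟨a', ha', haw⟩ := hflip β a ha
  obtain ⟨b', hb', hbw⟩ := hflip γ b hb
  obtain ⟨x, hx, h1, h2⟩ := exists_gt_re_pos_of_lt (abs_pos.mpr hβ) hβγ ha' hb' X
  exact ⟨x, hx, by rwa [← haw], by rwa [← hbw]⟩

/-- Two vectors that are not opposite lie in a common open half-plane. -/
theorem exists_re_pos_of_not_opposite {a b : ℂ} (ha : a ≠ 0) (hb : b ≠ 0)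
    (h : ¬ ∃ s : ℝ, 0 < s ∧ b = -s * a) : ∃ y : ℂ, 0 < (a * y).re ∧ 0 < (b * y).re := by
  have hna := norm_pos_iff.mpr ha
  have hnb := norm_pos_iff.mpr hb
  have hsq : ∀ c : ℂ, c.re * c.re + c.im * c.im = ‖c‖ * ‖c‖ := fun c => by
    rw [← sq ‖c‖, ← Complex.normSq_eq_norm_sq, Complex.normSq_apply]
  have ea := hsq a
  have eb := hsq b
  have hpos : 0 < ‖a‖ * ‖b‖ + (a.re * b.re + a.im * b.im) := by
    by_contra! hle
    refine h ⟨‖b‖ / ‖a‖, by positivity, ?_⟩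
    -- the vector `‖b‖ a + ‖a‖ b` has squared norm `2 ‖a‖ ‖b‖ (‖a‖ ‖b‖ + Re (a * conj b))`
    have hnn : (‖b‖ * a.re + ‖a‖ * b.re) ^ 2 + (‖b‖ * a.im + ‖a‖ * b.im) ^ 2 ≤ 0 := by
      have : (‖b‖ * a.re + ‖a‖ * b.re) ^ 2 + (‖b‖ * a.im + ‖a‖ * b.im) ^ 2 =
          2 * (‖a‖ * ‖b‖) * (‖a‖ * ‖b‖ + (a.re * b.re + a.im * b.im)) := by
        linear_combination ‖b‖ ^ 2 * ea + ‖a‖ ^ 2 * eb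
      rw [this]
      exact mul_nonpos_of_nonneg_of_nonpos (by positivity) hle
    have h1 : ‖b‖ * a.re + ‖a‖ * b.re = 0 := by nlinarith [sq_nonneg (‖b‖ * a.im + ‖a‖ * b.im)]
    have h2 : ‖b‖ * a.im + ‖a‖ * b.im = 0 := by nlinarith [sq_nonneg (‖b‖ * a.re + ‖a‖ * b.re)]
    have h3 : (‖b‖ : ℂ) * a + ‖a‖ * b = 0 := by
      apply Complex.ext <;> simp [h1, h2]
    have h4 : (‖a‖ : ℂ) ≠ 0 := by exact_mod_cast hna.ne'
    push_cast
    field_simp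
    linear_combination h3
  refine ⟨(starRingEnd ℂ) (‖b‖ * a + ‖a‖ * b), ?_, ?_⟩
  · have : (a * (starRingEnd ℂ) (‖b‖ * a + ‖a‖ * b)).re =
        ‖a‖ * (‖a‖ * ‖b‖ + (a.re * b.re + a.im * b.im)) := by
      simp
      linear_combination ‖b‖ * ea
    rw [this]; positivity
  · have : (b * (starRingEnd ℂ) (‖b‖ * a + ‖a‖ * b)).re =
        ‖b‖ * (‖a‖ * ‖b‖ + (a.re * b.re + a.im * b.im)) := by
      simp
      linear_combination ‖a‖ * eb
    rw [this]; positivity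

/-- Two rotating vectors that are never both in the open right half-plane after some time rotate
as opposite vectors, or as reflections of each other in the imaginary axis, up to scaling. -/
theorem opposite_of_never_re_pos {β γ : ℝ} (hβ : β ≠ 0) (hγ : γ ≠ 0) {a b : ℂ} (ha : a ≠ 0)
    (hb : b ≠ 0) {X : ℝ}
    (h : ∀ x, X < x → ¬ (0 < (a * wave β x).re ∧ 0 < (b * wave γ x).re)) :
    (γ = β ∧ ∃ s : ℝ, 0 < s ∧ b = -s * a) ∨
      (γ = -β ∧ ∃ s : ℝ, 0 < s ∧ b = -s * (starRingEnd ℂ) a) := by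
  have hsame : ∀ c : ℂ, c ≠ 0 → (∀ x, X < x → ¬ (0 < (a * wave β x).re ∧ 0 < (c * wave β x).re)) →
      ∃ s : ℝ, 0 < s ∧ c = -s * a := by
    intro c hc hcw
    by_contra hopp
    obtain ⟨y, hya, hyc⟩ := exists_re_pos_of_not_opposite ha hc hopp
    have hy : y ≠ 0 := by rintro rfl; simp at hya
    have hyn : 0 < ‖y‖⁻¹ := inv_pos.mpr (norm_pos_iff.mpr hy)
    obtain ⟨x, hx, hxw⟩ := exists_gt_wave_eq hβ (z := (‖y‖⁻¹ : ℝ) * y) (by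
      rw [norm_mul, Complex.norm_real, norm_inv, norm_norm,
        inv_mul_cancel₀ (norm_ne_zero_iff.mpr hy)]) X
    refine hcw x hx ⟨?_, ?_⟩
    · rw [hxw, mul_left_comm, Complex.re_ofReal_mul]; exact mul_pos hyn hya
    · rw [hxw, mul_left_comm, Complex.re_ofReal_mul]; exact mul_pos hyn hyc
  rcases lt_trichotomy |β| |γ| with hlt | heq | hlt
  · obtain ⟨x, hx, h1, h2⟩ := exists_gt_re_pos_of_abs_lt hβ hlt ha hb X
    exact absurd ⟨h1, h2⟩ (h x hx)
  · rcases abs_eq_abs.mp heq with e | e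
    · subst e
      exact Or.inl ⟨rfl, hsame b hb h⟩
    · right
      have hγβ : γ = -β := by rw [e, neg_neg]
      refine ⟨hγβ, ?_⟩
      obtain ⟨s, hs, e'⟩ := hsame ((starRingEnd ℂ) b) (by simpa using hb) fun x hx => by
        have := h x hx
        rw [← re_mul_wave_neg b γ x, ← e] at this
        exact this
      refine ⟨s, hs, ?_⟩
      have := congrArg (starRingEnd ℂ) e'
      simpa using this
  · obtain ⟨x, hx, h1, h2⟩ := exists_gt_re_pos_of_abs_lt hγ hlt hb ha X
    exact absurd ⟨h2, h1⟩ (h x hx)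

/-! ### Functions with decaying tails -/

/-- The function `G` is positive on `(R, ∞)` and on `(-∞, -R)`, nonincreasing on the former and
nondecreasing on the latter half-line, and takes arbitrarily small values on the former. -/
structure DecayingTails (G : ℝ → ℝ) (R : ℝ) : Prop where
  pos_right : ∀ x, R < x → 0 < G x
  pos_left : ∀ x, x < -R → 0 < G x
  antitoneOn : AntitoneOn G (Set.Ioi R)
  monotoneOn : MonotoneOn G (Set.Iio (-R))
  small : ∀ ε, 0 < ε → ∃ x, R < x ∧ G x < ε

namespace DecayingTails

variable {G : ℝ → ℝ} {R : ℝ}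

/-- Near `+∞` or near `-∞`, a combination of two distinct translates has a constant weak sign: this
is so wherever the larger translate has the larger coefficient (in absolute value), and each of the
two translates is the larger one on one of the two sides. -/
theorem exists_sign (hG : DecayingTails G R) {a₀ a₁ : ℝ} (ha : a₀ ≠ a₁) (d₀ d₁ : ℝ) :
    ∃ σ : ℝ, σ ≠ 0 ∧ ∃ X : ℝ,
      ((∀ x, X < x → 0 ≤ σ * (d₀ * G (x - a₀) + d₁ * G (x - a₁))) ∨
        (∀ x, x < -X → 0 ≤ σ * (d₀ * G (x - a₀) + d₁ * G (x - a₁)))) := by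
  have key : ∀ (d e : ℝ), |d| ≤ |e| →
      ∃ σ : ℝ, σ ≠ 0 ∧ ∀ u v : ℝ, 0 < u → u ≤ v → 0 ≤ σ * (d * u + e * v) := by
    intro d e hde
    by_cases he : e = 0
    · have : d = 0 := by simpa [he] using hde
      exact ⟨1, one_ne_zero, fun u v _ _ => by simp [he, this]⟩
    · refine ⟨e, he, fun u v hu huv => ?_⟩
      have h1 : |e * d| ≤ e * e := by
        rw [abs_mul, ← abs_mul_abs_self e]; gcongr
      have h2 := (abs_le.mp h1).1
      nlinarith [mul_self_nonneg e]
  wlog hlt : a₀ < a₁ generalizing a₀ a₁ d₀ d₁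
  · obtain ⟨σ, hσ, X, h⟩ := this ha.symm d₁ d₀ (lt_of_le_of_ne (not_lt.mp hlt) ha.symm)
    refine ⟨σ, hσ, X, ?_⟩
    simpa only [add_comm] using h
  have b₀ := abs_le.mp (le_refl |a₀|)
  have b₁ := abs_le.mp (le_refl |a₁|)
  have n₀ := abs_nonneg a₀
  have n₁ := abs_nonneg a₁
  rcases le_total |d₀| |d₁| with h | h
  · obtain ⟨σ, hσ, hk⟩ := key d₀ d₁ h
    refine ⟨σ, hσ, R + |a₀| + |a₁|, Or.inl fun x hx => hk _ _ ?_ ?_⟩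
    · exact hG.pos_right _ (by linarith)
    · exact hG.antitoneOn (Set.mem_Ioi.mpr (by linarith)) (Set.mem_Ioi.mpr (by linarith))
        (by linarith)
  · obtain ⟨σ, hσ, hk⟩ := key d₁ d₀ h
    refine ⟨σ, hσ, R + |a₀| + |a₁|, Or.inr fun x hx => ?_⟩
    rw [add_comm (d₀ * _)]
    refine hk _ _ ?_ ?_
    · exact hG.pos_left _ (by linarith)
    · exact hG.monotoneOn (Set.mem_Iio.mpr (by linarith)) (Set.mem_Iio.mpr (by linarith))
        (by linarith)

/-- A combination of two distinct translates cannot cancel an oscillating term on both sides. -/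
theorem not_ae_add_re_mul_wave_eq_zero (hG : DecayingTails G R) {a₀ a₁ : ℝ} (ha : a₀ ≠ a₁)
    (d₀ d₁ : ℝ) {β : ℝ} (hβ : β ≠ 0) {b : ℂ} (hb : b ≠ 0) (a : ℝ) (R' : ℝ) :
    ¬ ∀ᵐ x, R' < |x| →
      d₀ * G (x - a₀) + d₁ * G (x - a₁) + (b * wave β x).re * G (x - a) = 0 := by
  intro h
  obtain ⟨σ, hσ, X, hX⟩ := hG.exists_sign ha d₀ d₁
  have hσb : (σ : ℂ) * b ≠ 0 := mul_ne_zero (by exact_mod_cast hσ) hb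
  have n := abs_nonneg a
  have na := abs_le.mp (le_refl |a|)
  have m := abs_nonneg R'
  have m' := le_abs_self R'
  have o := abs_nonneg R
  have o' := le_abs_self R
  have p := abs_nonneg X
  have p' := le_abs_self X
  rcases hX with hX | hX
  · obtain ⟨x, hx, hpos, heq⟩ := exists_gt_re_mul_wave_pos hβ hσb h (|X| + |R'| + |R| + |a|)
    have h0 := heq (lt_of_lt_of_le (by linarith) (le_abs_self x))
    have h1 := hX x (by linarith)
    have h2 := mul_pos hpos (hG.pos_right (x - a) (by linarith))
    rw [mul_assoc, Complex.re_ofReal_mul] at h2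
    have h3 := congrArg (σ * ·) h0
    simp only [mul_zero] at h3
    linarith
  · obtain ⟨x, hx, hpos, heq⟩ := exists_lt_re_mul_wave_pos hβ hσb h (-(|X| + |R'| + |R| + |a|))
    have h0 := heq (lt_of_lt_of_le (by linarith) (neg_le_abs x))
    have h1 := hX x (by linarith)
    have h2 := mul_pos hpos (hG.pos_left (x - a) (by linarith))
    rw [mul_assoc, Complex.re_ofReal_mul] at h2
    have h3 := congrArg (σ * ·) h0
    simp only [mul_zero] at h3
    linarith

/-- Distinct translates are not proportional on both tails: the ratio would have to be `1`, and
a periodic tail does not decay. -/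
theorem not_ae_eq_mul (hG : DecayingTails G R) {a₀ a₁ : ℝ} (ha : a₀ ≠ a₁) {s : ℝ} (hs : 0 < s)
    (R' : ℝ) : ¬ ∀ᵐ x, R' < |x| → G (x - a₀) = s * G (x - a₁) := by
  intro h
  wlog hlt : a₀ < a₁ generalizing a₀ a₁ s
  · refine this ha.symm (inv_pos.mpr hs) ?_ (lt_of_le_of_ne (not_lt.mp hlt) ha.symm)
    filter_upwards [h] with x hx hR
    rw [hx hR, inv_mul_cancel_left₀ hs.ne']
  have b₀ := abs_le.mp (le_refl |a₀|)
  have b₁ := abs_le.mp (le_refl |a₁|)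
  have n₀ := abs_nonneg a₀
  have n₁ := abs_nonneg a₁
  have m := abs_nonneg R'
  have m' := le_abs_self R'
  have o := abs_nonneg R
  have o' := le_abs_self R
  set M := |R'| + |R| + |a₀| + |a₁| with hM
  have hle : s ≤ 1 := by
    obtain ⟨x, hx, hxe⟩ := exists_mem_of_isOpen_of_ae (isOpen_Ioi (a := M)) ⟨M + 1, by simp⟩ h
    have hx' : M < x := hx
    have h1 := hxe (lt_of_lt_of_le (by linarith) (le_abs_self x))
    have h2 := hG.pos_right (x - a₁) (by linarith)
    have h3 : G (x - a₀) ≤ G (x - a₁) :=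
      hG.antitoneOn (Set.mem_Ioi.mpr (by linarith)) (Set.mem_Ioi.mpr (by linarith)) (by linarith)
    exact le_of_mul_le_mul_right (by linarith) h2
  have hge : 1 ≤ s := by
    obtain ⟨x, hx, hxe⟩ := exists_mem_of_isOpen_of_ae (isOpen_Iio (a := -M))
      ⟨-M - 1, by simp⟩ h
    have hx' : x < -M := hx
    have h1 := hxe (lt_of_lt_of_le (by linarith) (neg_le_abs x))
    have h2 := hG.pos_left (x - a₁) (by linarith)
    have h3 : G (x - a₁) ≤ G (x - a₀) :=
      hG.monotoneOn (Set.mem_Iio.mpr (by linarith)) (Set.mem_Iio.mpr (by linarith)) (by linarith)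
    exact le_of_mul_le_mul_right (by linarith) h2
  obtain rfl : s = 1 := le_antisymm hle hge
  set p := a₁ - a₀ with hp
  have hp0 : 0 < p := sub_pos.mpr hlt
  have hall : ∀ᵐ x, ∀ n : ℕ, R' < |x + n * p| →
      G (x + n * p - a₀) = G (x + n * p - a₁) := by
    rw [ae_all_iff]
    intro n
    have := (measurePreserving_add_right (volume : Measure ℝ) (n * p)).quasiMeasurePreserving.ae h
    simpa using this
  obtain ⟨x, hx, hxe⟩ := exists_mem_of_isOpen_of_ae (isOpen_Ioi (a := M)) ⟨M + 1, by simp⟩ hall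
  have hx' : M < x := hx
  have hper : ∀ n : ℕ, G (x + n * p - a₀) = G (x - a₁) := by
    intro n
    induction n with
    | zero =>
      have := hxe 0
      simp only [Nat.cast_zero, zero_mul, add_zero] at this ⊢
      exact this (lt_of_lt_of_le (by linarith) (le_abs_self x))
    | succ n ih =>
      have hn : 0 ≤ ((n + 1 : ℕ) : ℝ) * p := by positivity
      rw [hxe (n + 1) (lt_of_lt_of_le (by linarith) (le_abs_self _)), ← ih]
      congr 1
      push_cast
      rw [hp]; ring
  obtain ⟨y, hyR, hy⟩ := hG.small _ (hG.pos_right (x - a₁) (by linarith))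
  obtain ⟨n, hn⟩ := exists_nat_gt ((y - (x - a₀)) / p)
  rw [div_lt_iff₀ hp0] at hn
  have hnp : 0 ≤ (n : ℝ) * p := by positivity
  have := hG.antitoneOn (Set.mem_Ioi.mpr hyR)
    (Set.mem_Ioi.mpr (by linarith : R < x + n * p - a₀)) (by linarith)
  rw [hper n] at this
  linarith

/-- A group of at most three translates with a common frequency is not cancelled by a single
translate of a different frequency. One of the coefficients of the group is made purely imaginary,
and the real parts are compared. -/
theorem not_ae_three_add_wave_eq_zero (hG : DecayingTails G R) {a₀ a₁ : ℝ} (ha : a₀ ≠ a₁)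
    (c₀ c₁ c₂ : ℂ) {c₃ : ℂ} (hc₃ : c₃ ≠ 0) {β : ℝ} (hβ : β ≠ 0) (a₂ a₃ R' : ℝ) :
    ¬ ∀ᵐ x, R' < |x| → c₀ * G (x - a₀) + c₁ * G (x - a₁) + c₂ * G (x - a₂) +
      c₃ * wave β x * G (x - a₃) = 0 := by
  intro h
  obtain ⟨y, hy, hy2⟩ : ∃ y : ℂ, y ≠ 0 ∧ (y * c₂).re = 0 := by
    by_cases h2 : c₂ = 0
    · exact ⟨1, one_ne_zero, by simp [h2]⟩
    · refine ⟨Complex.I * (starRingEnd ℂ) c₂, by simpa using h2, ?_⟩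
      simp [mul_assoc]
      ring
  refine hG.not_ae_add_re_mul_wave_eq_zero ha (y * c₀).re (y * c₁).re hβ
    (mul_ne_zero hy hc₃) a₃ R' ?_
  filter_upwards [h] with x hx hR
  have h1 : (y * c₀) * G (x - a₀) + (y * c₁) * G (x - a₁) + (y * c₂) * G (x - a₂) +
      (y * c₃ * wave β x) * G (x - a₃) = 0 := by linear_combination y * hx hR
  have h2 := congrArg Complex.re h1
  simpa only [Complex.add_re, Complex.re_mul_ofReal, hy2, zero_mul, add_zero, Complex.zero_re]
    using h2

end DecayingTails

theorem ae_re_mul_wave_ne_zero {β : ℝ} (hβ : β ≠ 0) {b : ℂ} (hb : b ≠ 0) :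
    ∀ᵐ x, (b * wave β x).re ≠ 0 := by
  have hinj : Set.InjOn (fun i : Bool => cond i β (-β)) (Finset.univ : Finset Bool) := by
    have : -β ≠ β := fun e => hβ (by linarith)
    intro i _ j _ hij
    cases i <;> cases j <;> simp_all [eq_comm]
  filter_upwards [ae_sum_wave_ne_zero (c := fun i : Bool => cond i b ((starRingEnd ℂ) b)) hinj
    (Finset.mem_univ true) hb] with x hx h0
  refine hx ?_
  simp only [Fintype.sum_bool, cond_true, cond_false]
  rw [← conj_wave, ← map_mul, Complex.add_conj, h0]; simp

namespace DecayingTails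

variable {G : ℝ → ℝ} {R : ℝ}

/-- If two oscillating terms cancel in their real parts, then they rotate as opposite or as
reflected vectors, and their translates of `G` are proportional on both tails. -/
theorem opposite_of_ae_re_add_re_eq_zero (hG : DecayingTails G R) {b c : ℂ} (hb : b ≠ 0)
    (hc : c ≠ 0) {β γ : ℝ} (hβ : β ≠ 0) (hγ : γ ≠ 0) {a₂ a₃ R' : ℝ}
    (h : ∀ᵐ x, R' < |x| →
      (b * wave β x).re * G (x - a₂) + (c * wave γ x).re * G (x - a₃) = 0) :
    ∃ s : ℝ, 0 < s ∧ (∀ᵐ x, R' < |x| → G (x - a₂) = s * G (x - a₃)) ∧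
      ((γ = β ∧ c = -s * b) ∨ (γ = -β ∧ c = -s * (starRingEnd ℂ) b)) := by
  have n₂ := abs_nonneg a₂
  have b₂ := le_abs_self a₂
  have n₃ := abs_nonneg a₃
  have b₃ := le_abs_self a₃
  have m := abs_nonneg R'
  have m' := le_abs_self R'
  have o := abs_nonneg R
  have o' := le_abs_self R
  have hnever : ∀ x, |R'| + |R| + |a₂| + |a₃| < x →
      ¬ (0 < (b * wave β x).re ∧ 0 < (c * wave γ x).re) := by
    intro x hx hpos
    obtain ⟨z, ⟨hz, hz2, hz3⟩, hze⟩ := exists_mem_of_isOpen_of_ae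
      (isOpen_Ioi.inter ((isOpen_re_mul_wave_pos b β).inter (isOpen_re_mul_wave_pos c γ)))
      ⟨x, hx, hpos.1, hpos.2⟩ h
    have hz' : |R'| + |R| + |a₂| + |a₃| < z := hz
    have h0 := hze (lt_of_lt_of_le (by linarith) (le_abs_self z))
    have h2 := mul_pos hz2 (hG.pos_right (z - a₂) (by linarith))
    have h3 := mul_pos hz3 (hG.pos_right (z - a₃) (by linarith))
    linarith
  obtain ⟨s, hs, hcase, hre⟩ : ∃ s : ℝ, 0 < s ∧
      ((γ = β ∧ c = -s * b) ∨ (γ = -β ∧ c = -s * (starRingEnd ℂ) b)) ∧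
      ∀ x, (c * wave γ x).re = -s * (b * wave β x).re := by
    rcases opposite_of_never_re_pos hβ hγ hb hc hnever with ⟨e, s, hs, e'⟩ | ⟨e, s, hs, e'⟩
    · refine ⟨s, hs, Or.inl ⟨e, e'⟩, fun x => ?_⟩
      rw [e, e', ← Complex.ofReal_neg, mul_assoc, Complex.re_ofReal_mul]
    · refine ⟨s, hs, Or.inr ⟨e, e'⟩, fun x => ?_⟩
      rw [e, e', ← Complex.ofReal_neg, mul_assoc, Complex.re_ofReal_mul, re_mul_wave_neg]
  refine ⟨s, hs, ?_, hcase⟩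
  filter_upwards [h, ae_re_mul_wave_ne_zero hβ hb] with x hx hne hR
  have h1 := hx hR
  rw [hre] at h1
  have h2 : (b * wave β x).re * (G (x - a₂) - s * G (x - a₃)) = 0 := by linarith
  exact sub_eq_zero.mp ((mul_eq_zero.mp h2).resolve_left hne)

/-- A dependency of four translates, two of which have the same frequency and coefficients on a
common real line, is impossible. Modulo this line only the other two terms remain, so their
translates are proportional, hence equal. Then they have frequencies `±β` and conjugate
coefficients relative to the line, and add up to a real oscillating term, which the first two
cannot cancel on both sides. -/
theorem not_ae_collinear_pair (hG : DecayingTails G R) {a₀ a₁ : ℝ} (ha : a₀ ≠ a₁)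
    {c₀ c₁ c₂ c₃ : ℂ} (hc₀ : c₀ ≠ 0) {r : ℝ} (hc₁ : c₁ = -r * c₀) (hc₂ : c₂ ≠ 0) (hc₃ : c₃ ≠ 0)
    {β γ : ℝ} (hβ : β ≠ 0) (hγ : γ ≠ 0) {a₂ a₃ : ℝ} (ha' : γ = β → a₂ ≠ a₃) (R' : ℝ) :
    ¬ ∀ᵐ x, R' < |x| → c₀ * G (x - a₀) + c₁ * G (x - a₁) + c₂ * wave β x * G (x - a₂) +
      c₃ * wave γ x * G (x - a₃) = 0 := by
  intro h
  set b := c₂ / c₀ with hb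
  set c := c₃ / c₀ with hc
  have hb0 : b ≠ 0 := div_ne_zero hc₂ hc₀
  have hc0 : c ≠ 0 := div_ne_zero hc₃ hc₀
  have hI := Complex.I_ne_zero
  have h' : ∀ᵐ x, R' < |x| → (G (x - a₀) : ℂ) + ((-r : ℝ) : ℂ) * G (x - a₁) +
      b * wave β x * G (x - a₂) + c * wave γ x * G (x - a₃) = 0 := by
    filter_upwards [h] with x hx hR
    have := hx hR
    rw [hc₁] at this
    rw [hb, hc]
    push_cast
    field_simp
    linear_combination this
  obtain ⟨s, hs, hprop, hcase⟩ := hG.opposite_of_ae_re_add_re_eq_zero (a₂ := a₂) (a₃ := a₃)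
    (R' := R') (mul_ne_zero hI hb0) (mul_ne_zero hI hc0) hβ hγ (by
      filter_upwards [h'] with x hx hR
      have := congrArg (fun z => (Complex.I * z).re) (hx hR)
      simp only [mul_add, mul_zero, Complex.zero_re, Complex.add_re] at this
      rw [← this]
      simp only [← mul_assoc, Complex.re_mul_ofReal]
      simp)
  have haa : a₂ = a₃ := by
    by_contra hne
    exact hG.not_ae_eq_mul hne hs R' hprop
  subst haa
  rcases hcase with ⟨e, -⟩ | ⟨e, e'⟩
  · exact ha' e rfl
  have hs1 : s = 1 := by
    obtain ⟨x, hx, hxe⟩ := exists_mem_of_isOpen_of_ae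
      (isOpen_Ioi (a := |R'| + |R| + |a₂|)) ⟨|R'| + |R| + |a₂| + 1, by simp⟩ hprop
    have hx' : |R'| + |R| + |a₂| < x := hx
    have h0 := hG.pos_right (x - a₂)
      (by linarith [le_abs_self R, le_abs_self a₂, abs_nonneg R'])
    have h1 := hxe (lt_of_lt_of_le (by linarith [le_abs_self R', abs_nonneg R, abs_nonneg a₂])
      (le_abs_self x))
    have h2 : (s - 1) * G (x - a₂) = 0 := by linarith
    linarith [(mul_eq_zero.mp h2).resolve_right h0.ne']
  have hcb : c = (starRingEnd ℂ) b := by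
    refine mul_left_cancel₀ hI ?_
    rw [e', hs1, map_mul, Complex.conj_I]; push_cast; ring
  refine hG.not_ae_add_re_mul_wave_eq_zero ha 1 (-r) hβ
    (mul_ne_zero two_ne_zero hb0) a₂ R' ?_
  filter_upwards [h'] with x hx hR
  have h1 := congrArg Complex.re (hx hR)
  simp only [Complex.add_re, Complex.re_mul_ofReal, Complex.ofReal_re, Complex.zero_re] at h1
  rw [e, hcb, re_mul_wave_neg] at h1
  have h2 : (2 * b * wave β x).re = 2 * (b * wave β x).re := by
    rw [mul_assoc, show (2 : ℂ) = ((2 : ℝ) : ℂ) by norm_num, Complex.re_ofReal_mul]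
  rw [h2]
  linarith

/-- A dependency of four translates is impossible if two of them have the same frequency and the
others have not. If the coefficients of the pair are not opposite, then they lie in a common open
half-plane, and in several of them; the positivity of `G` alone then forces the other two terms to
be a pair of the same frequency with opposite coefficients. -/
theorem not_ae_pair_add_waves_eq_zero (hG : DecayingTails G R) {a₀ a₁ : ℝ} (ha : a₀ ≠ a₁)
    {c₀ c₁ c₂ c₃ : ℂ} (hc₀ : c₀ ≠ 0) (hc₁ : c₁ ≠ 0) (hc₂ : c₂ ≠ 0) (hc₃ : c₃ ≠ 0)
    {β γ : ℝ} (hβ : β ≠ 0) (hγ : γ ≠ 0) {a₂ a₃ : ℝ} (ha' : γ = β → a₂ ≠ a₃) (R' : ℝ) :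
    ¬ ∀ᵐ x, R' < |x| → c₀ * G (x - a₀) + c₁ * G (x - a₁) + c₂ * wave β x * G (x - a₂) +
      c₃ * wave γ x * G (x - a₃) = 0 := by
  intro h
  by_cases hopp : ∃ r : ℝ, 0 < r ∧ c₁ = -r * c₀
  · obtain ⟨r, -, hr⟩ := hopp
    exact hG.not_ae_collinear_pair ha hc₀ hr hc₂ hc₃ hβ hγ ha' R' h
  -- the roles of the two pairs can be interchanged
  have hswap : ¬ (γ = β ∧ ∃ s : ℝ, 0 < s ∧ c₃ = -s * c₂) := by
    rintro ⟨rfl, s, -, hs⟩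
    refine hG.not_ae_collinear_pair (ha' rfl) hc₂ hs hc₀ hc₁ (neg_ne_zero.mpr hγ)
      (neg_ne_zero.mpr hγ) (fun _ => ha) R' ?_
    filter_upwards [h] with x hx hR
    linear_combination wave (-γ) x * hx hR -
      (c₂ * G (x - a₂) + c₃ * G (x - a₃)) * wave_neg_mul_wave γ x
  -- a half-plane containing the coefficients of the pair never contains both other terms
  have hrefl : ∀ y : ℂ, 0 < (c₀ * y).re → 0 < (c₁ * y).re →
      ∃ s : ℝ, 0 < s ∧ c₃ * y = -s * (starRingEnd ℂ) (c₂ * y) := by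
    intro y hy0 hy1
    have hy : y ≠ 0 := by rintro rfl; simp at hy0
    have hnever : ∀ x, |R'| + |R| + |a₀| + |a₁| + |a₂| + |a₃| < x →
        ¬ (0 < (c₂ * y * wave β x).re ∧ 0 < (c₃ * y * wave γ x).re) := by
      intro x hx hpos
      obtain ⟨z, ⟨hz, hz2, hz3⟩, hze⟩ := exists_mem_of_isOpen_of_ae
        (isOpen_Ioi.inter ((isOpen_re_mul_wave_pos (c₂ * y) β).inter
          (isOpen_re_mul_wave_pos (c₃ * y) γ))) ⟨x, hx, hpos.1, hpos.2⟩ h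
      have hz' : |R'| + |R| + |a₀| + |a₁| + |a₂| + |a₃| < z := hz
      have m := abs_nonneg R'
      have o := abs_nonneg R
      have o' := le_abs_self R
      have n₀ := abs_nonneg a₀
      have n₁ := abs_nonneg a₁
      have n₂ := abs_nonneg a₂
      have n₃ := abs_nonneg a₃
      have h0 := hze (lt_of_lt_of_le (by linarith [le_abs_self R']) (le_abs_self z))
      have e0 := mul_pos hy0 (hG.pos_right (z - a₀) (by linarith [le_abs_self a₀]))
      have e1 := mul_pos hy1 (hG.pos_right (z - a₁) (by linarith [le_abs_self a₁]))
      have e2 := mul_pos hz2 (hG.pos_right (z - a₂) (by linarith [le_abs_self a₂]))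
      have e3 := mul_pos hz3 (hG.pos_right (z - a₃) (by linarith [le_abs_self a₃]))
      have h1 : (c₀ * y) * G (z - a₀) + (c₁ * y) * G (z - a₁) + (c₂ * y * wave β z) * G (z - a₂) +
          (c₃ * y * wave γ z) * G (z - a₃) = 0 := by linear_combination y * h0
      have h2 := congrArg Complex.re h1
      simp only [Complex.add_re, Complex.re_mul_ofReal, Complex.zero_re] at h2
      linarith
    rcases opposite_of_never_re_pos hβ hγ (mul_ne_zero hc₂ hy) (mul_ne_zero hc₃ hy) hnever with
      ⟨e, s, hs, e'⟩ | ⟨-, s, hs, e'⟩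
    · refine absurd ⟨e, s, hs, mul_right_cancel₀ hy ?_⟩ hswap
      rw [e']; ring
    · exact ⟨s, hs, e'⟩
  -- two such half-planes in different directions
  obtain ⟨y, hy0, hy1⟩ := exists_re_pos_of_not_opposite hc₀ hc₁ hopp
  have hy : y ≠ 0 := by rintro rfl; simp at hy0
  obtain ⟨ε, hε, hε0, hε1⟩ : ∃ ε : ℝ, 0 < ε ∧ ε * (c₀ * y).im < (c₀ * y).re ∧
      ε * (c₁ * y).im < (c₁ * y).re := by
    have t0 : Tendsto (fun ε : ℝ => ε * (c₀ * y).im) (nhdsWithin 0 (Set.Ioi 0)) (nhds 0) := by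
      have : Continuous fun ε : ℝ => ε * (c₀ * y).im := by fun_prop
      simpa using (this.tendsto 0).mono_left nhdsWithin_le_nhds
    have t1 : Tendsto (fun ε : ℝ => ε * (c₁ * y).im) (nhdsWithin 0 (Set.Ioi 0)) (nhds 0) := by
      have : Continuous fun ε : ℝ => ε * (c₁ * y).im := by fun_prop
      simpa using (this.tendsto 0).mono_left nhdsWithin_le_nhds
    obtain ⟨ε, h0, h1, h2⟩ := ((t0.eventually_lt_const hy0).and
      ((t1.eventually_lt_const hy1).and self_mem_nhdsWithin)).exists
    exact ⟨ε, h2, h0, h1⟩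
  have hturn : ∀ c : ℂ, (c * (y * (1 + ε * Complex.I))).re = (c * y).re - ε * (c * y).im := by
    intro c
    rw [← mul_assoc, mul_add, mul_one, Complex.add_re, mul_left_comm, Complex.re_ofReal_mul,
      Complex.mul_I_re]
    ring
  obtain ⟨s, hs, es⟩ := hrefl y hy0 hy1
  obtain ⟨t, ht, et⟩ := hrefl (y * (1 + ε * Complex.I)) (by rw [hturn]; linarith)
    (by rw [hturn]; linarith)
  have hK : (starRingEnd ℂ) (c₂ * y) ≠ 0 := by
    simpa using ⟨hc₂, hy⟩
  have key : (s : ℂ) * (1 + ε * Complex.I) = t * (1 - ε * Complex.I) := by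
    refine mul_right_cancel₀ hK ?_
    have : (starRingEnd ℂ) (c₂ * (y * (1 + ε * Complex.I))) =
        (starRingEnd ℂ) (c₂ * y) * (1 - ε * Complex.I) := by
      simp; ring
    rw [this] at et
    linear_combination (1 + ε * Complex.I) * es - et
  have k2 := congrArg Complex.im key
  simp at k2
  nlinarith [mul_pos hs hε, mul_pos ht hε]

end DecayingTails

/-! ### Gabor systems -/

theorem gaborShift_eq_wave_mul (g : ℝ → ℂ) (p : ℝ × ℝ) (x : ℝ) :
    gaborShift g p x = wave p.2 x * g (x - p.1) := rfl

/-- The hypotheses on `g` in terms of its real part. The tail takes small values because `g` is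
square-integrable. -/
theorem exists_decayingTails {g : ℝ → ℂ} (hg : MemLp g 2 volume)
    (hpos : UltimatelyPositive g) (hdec : UltimatelyDecreasing g)
    (hpos' : UltimatelyPositive (fun x => g (-x)))
    (hdec' : UltimatelyDecreasing (fun x => g (-x))) :
    ∃ R : ℝ, DecayingTails (fun x => (g x).re) R ∧ ∀ x, R < |x| → g x = ((g x).re : ℂ) := by
  obtain ⟨x₁, h₁⟩ := hpos
  obtain ⟨x₂, h₂⟩ := hdec
  obtain ⟨x₃, h₃⟩ := hpos'
  obtain ⟨x₄, h₄⟩ := hdec'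
  have r₁ := le_abs_self x₁
  have r₂ := le_abs_self x₂
  have r₃ := le_abs_self x₃
  have r₄ := le_abs_self x₄
  have n₁ := abs_nonneg x₁
  have n₂ := abs_nonneg x₂
  have n₃ := abs_nonneg x₃
  have n₄ := abs_nonneg x₄
  set R := |x₁| + |x₂| + |x₃| + |x₄| with hR
  have hright : ∀ x, R < x → 0 < g x := fun x hx => h₁ x (by linarith)
  have hleft : ∀ x, x < -R → 0 < g x := fun x hx => by
    simpa using h₃ (-x) (by linarith)
  have hreal : ∀ z : ℂ, 0 < z → z = (z.re : ℂ) := fun z hz =>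
    Complex.ext rfl (by simpa using (Complex.pos_iff.mp hz).2.symm)
  refine ⟨R, ⟨fun x hx => (Complex.pos_iff.mp (hright x hx)).1,
    fun x hx => (Complex.pos_iff.mp (hleft x hx)).1, fun x hx y hy hxy => ?_,
    fun x hx y hy hxy => ?_, fun ε hε => ?_⟩, fun x hx => ?_⟩
  · have hx' := Set.mem_Ioi.mp hx
    have hy' := Set.mem_Ioi.mp hy
    exact (Complex.le_def.mp (h₂ (Set.mem_Ioi.mpr (by linarith)) (Set.mem_Ioi.mpr (by linarith))
      hxy)).1
  · have hx' := Set.mem_Iio.mp hx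
    have hy' := Set.mem_Iio.mp hy
    have := h₄ (Set.mem_Ioi.mpr (by linarith : x₄ < -y)) (Set.mem_Ioi.mpr (by linarith : x₄ < -x))
      (neg_le_neg hxy)
    simpa using (Complex.le_def.mp this).1
  · by_contra! hcon
    have hfin : volume {x | ENNReal.ofReal ε ≤ ‖g x‖ₑ} < ⊤ :=
      hg.meas_ge_lt_top'_enorm (by norm_num) (by norm_num) (by simpa using hε) (by simp)
    have hsub : Set.Ioi R ⊆ {x | ENNReal.ofReal ε ≤ ‖g x‖ₑ} := fun x hx => by
      rw [Set.mem_ofPred_eq, ← ofReal_norm]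
      exact ENNReal.ofReal_le_ofReal ((hcon x hx).trans (Complex.re_le_norm _))
    have := (measure_mono hsub).trans_lt hfin
    simp at this
  · rcases lt_abs.mp hx with h | h
    · exact hreal _ (hright x h)
    · exact hreal _ (hleft x (by linarith))

/-- A dependency of at most four time-frequency shifts, all of whose coefficients are nonzero, is
impossible. The cases are distinguished by which points share a frequency: none do, all do, all but
one do, or exactly two do (the others having the same frequency or not). -/
theorem not_ae_sum_gaborShift_eq_zero {g : ℝ → ℂ} (hg : MemLp g 2 volume) {R : ℝ}
    (hG : DecayingTails (fun x => (g x).re) R) (hreal : ∀ x, R < |x| → g x = ((g x).re : ℂ))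
    {S : Finset (ℝ × ℝ)} (hS : S.Nonempty) (hcard : S.card ≤ 4) {C : ℝ × ℝ → ℂ}
    (hC : ∀ p ∈ S, C p ≠ 0) : ¬ ∀ᵐ x, ∑ p ∈ S, C p * gaborShift g p x = 0 := by
  classical
  intro h
  set G : ℝ → ℝ := fun x => (g x).re with hGdef
  set R' := |R| + ∑ p ∈ S, |p.1| with hR'
  have hfar : ∀ p ∈ S, ∀ x, R' < |x| → R < |x - p.1| := by
    intro p hp x hx
    have h1 : |p.1| ≤ ∑ q ∈ S, |q.1| :=
      Finset.single_le_sum (f := fun q : ℝ × ℝ => |q.1|) (fun q _ => abs_nonneg _) hp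
    have h2 := abs_sub_abs_le_abs_sub x p.1
    linarith [le_abs_self R]
  have htail : ∀ᵐ x, R' < |x| → ∑ p ∈ S, C p * wave p.2 x * G (x - p.1) = 0 := by
    filter_upwards [h] with x hx hxR
    rw [← hx]
    refine Finset.sum_congr rfl fun p hp => ?_
    rw [gaborShift_eq_wave_mul, hreal _ (hfar p hp x hxR), mul_assoc]
  by_cases hinj : Set.InjOn Prod.snd (S : Set (ℝ × ℝ))
  · refine weighted_waves_ne_zero hS hcard hinj hC (w := fun p x => G (x - p.1)) (X := R')
      (fun p hp x hx => ?_) ?_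
    · have h1 : |p.1| ≤ ∑ q ∈ S, |q.1| :=
        Finset.single_le_sum (f := fun q : ℝ × ℝ => |q.1|) (fun q _ => abs_nonneg _) hp
      exact hG.pos_right _ (by linarith [le_abs_self R, le_abs_self p.1])
    · filter_upwards [htail] with x hx hxR
      exact hx (hxR.trans_le (le_abs_self x))
  -- two of the points have the same frequency
  obtain ⟨p, hp, q, hq, hpq2, hpq⟩ : ∃ p ∈ S, ∃ q ∈ S, p.2 = q.2 ∧ p ≠ q := by
    simpa [Set.InjOn, and_assoc] using hinj
  have hpq1 : p.1 ≠ q.1 := fun e => hpq (Prod.ext e hpq2)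
  by_cases hpure : ∀ t ∈ S, t.2 = p.2
  · -- a dependency of translates
    have h0 : g =ᵐ[volume] 0 := by
      refine ae_eq_zero_of_sum_translates (s := S) (a := Prod.fst) (c := C) (k := p)
        (fun s hs t ht e => Prod.ext e ((hpure s hs).trans (hpure t ht).symm)) hp (hC p hp) hg ?_
      filter_upwards [h] with x hx
      refine (mul_eq_zero.mp (?_ : wave p.2 x * _ = 0)).resolve_left (wave_ne_zero _ _)
      rw [← hx, Finset.mul_sum]
      refine Finset.sum_congr rfl fun t ht => ?_
      rw [gaborShift_eq_wave_mul, hpure t ht]; ring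
    obtain ⟨x, hx, hx0⟩ := exists_mem_of_isOpen_of_ae (isOpen_Ioi (a := R)) ⟨R + 1, by simp⟩ h0
    have := hG.pos_right x hx
    rw [hGdef] at this
    simp [hx0] at this
  push Not at hpure
  obtain ⟨t, ht, htp⟩ := hpure
  have htp' : t ≠ p := fun e => htp (by rw [e])
  have htq' : t ≠ q := fun e => htp (by rw [e, hpq2])
  have hq1 : q ∈ S.erase p := Finset.mem_erase.mpr ⟨hpq.symm, hq⟩
  have ht2 : t ∈ (S.erase p).erase q :=
    Finset.mem_erase.mpr ⟨htq', Finset.mem_erase.mpr ⟨htp', ht⟩⟩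
  set U := ((S.erase p).erase q).erase t with hU
  have hUcard : U.card ≤ 1 := by
    rw [hU, Finset.card_erase_of_mem ht2, Finset.card_erase_of_mem hq1,
      Finset.card_erase_of_mem hp]
    omega
  -- normalization: the common frequency becomes zero
  have hnorm : ∀ᵐ x, R' < |x| → C p * G (x - p.1) + C q * G (x - q.1) +
      C t * wave (t.2 - p.2) x * G (x - t.1) +
      ∑ u ∈ U, C u * wave (u.2 - p.2) x * G (x - u.1) = 0 := by
    filter_upwards [htail] with x hx hxR
    have h1 := hx hxR
    rw [← Finset.add_sum_erase S _ hp, ← Finset.add_sum_erase _ _ hq1,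
      ← Finset.add_sum_erase _ _ ht2, ← hpq2] at h1
    have h2 : ∑ u ∈ U, C u * wave (u.2 - p.2) x * G (x - u.1) =
        wave (-p.2) x * ∑ u ∈ U, C u * wave u.2 x * G (x - u.1) := by
      rw [Finset.mul_sum]
      refine Finset.sum_congr rfl fun u _ => ?_
      rw [sub_eq_add_neg, wave_add]; ring
    rw [h2, sub_eq_add_neg t.2, wave_add]
    linear_combination wave (-p.2) x * h1 -
      (C p * G (x - p.1) + C q * G (x - q.1)) * wave_neg_mul_wave p.2 x
  have hβ : t.2 - p.2 ≠ 0 := sub_ne_zero.mpr htp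
  rcases Finset.eq_empty_or_nonempty U with hU0 | ⟨u, hu⟩
  · refine hG.not_ae_three_add_wave_eq_zero hpq1 (C p) (C q) 0 (hC t ht) hβ 0 t.1 R' ?_
    filter_upwards [hnorm] with x hx hxR
    have := hx hxR
    rw [hU0, Finset.sum_empty] at this
    linear_combination this
  have hU1 : U = {u} :=
    Finset.eq_singleton_iff_unique_mem.mpr ⟨hu, fun v hv => Finset.card_le_one.mp hUcard v hv u hu⟩
  have hut : u ≠ t := (Finset.mem_erase.mp hu).1
  have huS : u ∈ S := Finset.mem_of_mem_erase (Finset.mem_of_mem_erase (Finset.mem_of_mem_erase hu))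
  rw [hU1] at hnorm
  simp only [Finset.sum_singleton] at hnorm
  by_cases hup : u.2 = p.2
  · refine hG.not_ae_three_add_wave_eq_zero hpq1 (C p) (C q) (C u) (hC t ht) hβ u.1 t.1 R' ?_
    filter_upwards [hnorm] with x hx hxR
    have := hx hxR
    rw [hup, sub_self, wave_zero] at this
    linear_combination this
  · refine hG.not_ae_pair_add_waves_eq_zero hpq1 (hC p hp) (hC q hq) (hC t ht) (hC u huS) hβ
      (sub_ne_zero.mpr hup) (fun e e' => hut (Prod.ext e'.symm ?_)) R' hnorm
    linarith

theorem theorem5p6 (g : ℝ → ℂ) (hg : MemLp g 2 volume)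
    (hpos : UltimatelyPositive g) (hdec : UltimatelyDecreasing g)
    (hpos' : UltimatelyPositive (fun x => g (-x)))
    (hdec' : UltimatelyDecreasing (fun x => g (-x)))
    (Λ : Finset (ℝ × ℝ)) (hΛ : Λ.card = 4) :
    HRTHolds g hg Λ := by
  classical
  obtain ⟨R, hG, hreal⟩ := exists_decayingTails hg hpos hdec hpos' hdec'
  unfold HRTHolds
  rw [Fintype.linearIndependent_iff]
  intro c hc
  by_contra! hne
  obtain ⟨i, hi⟩ := hne
  set C : ℝ × ℝ → ℂ := fun p => if h : p ∈ Λ then c ⟨p, h⟩ else 0 with hCdef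
  have hCc : ∀ p : {p : ℝ × ℝ // p ∈ Λ}, C p = c p := fun p => by simp [hCdef]
  refine not_ae_sum_gaborShift_eq_zero hg hG hreal (S := {p ∈ Λ | C p ≠ 0}) (C := C)
    ⟨i, by simp [hCc, hi]⟩ ((Finset.card_filter_le _ _).trans hΛ.le)
    (fun p hp => (Finset.mem_filter.mp hp).2) ?_
  have h0 : ∀ᵐ x, ∑ p : {p : ℝ × ℝ // p ∈ Λ}, c p * gaborShift g p x = 0 := by
    have h1 : ∀ᵐ x, ∀ p : {p : ℝ × ℝ // p ∈ Λ}, (c p • gaborSystem g hg Λ p) x =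
        c p * gaborShift g p x := by
      rw [ae_all_iff]
      intro p
      filter_upwards [Lp.coeFn_smul (c p) (gaborSystem g hg Λ p),
        (gaborShift_memLp hg p.1).coeFn_toLp] with x hx hx'
      rw [hx, Pi.smul_apply, smul_eq_mul]
      unfold gaborSystem
      rw [hx']
    have h2 := Lp.coeFn_fun_finsetSum Finset.univ
      (fun p : {p : ℝ × ℝ // p ∈ Λ} => c p • gaborSystem g hg Λ p)
    rw [hc] at h2
    filter_upwards [h1, h2, Lp.coeFn_zero ℂ 2 (volume : Measure ℝ)] with x hx1 hx2 hx3
    rw [← Finset.sum_congr rfl fun p _ => hx1 p, ← hx2, hx3, Pi.zero_apply]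
  filter_upwards [h0] with x hx
  rw [Finset.sum_filter_of_ne fun p _ hp => left_ne_zero_of_mul hp, ← hx,
    ← Finset.sum_coe_sort Λ]
  exact Finset.sum_congr rfl fun p _ => by rw [hCc]
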